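/- Let $P=(P_{a,b})_{a,b\in S}$ be the transition matrix of an irreducible Markov chain on a countable state space $S$ which has a stationary probability distribution $\pi=(\pi_a)_{a\in S}$ (in particular, this covers every ergodic chain; aperiodicity is not required), and let $i\in S$. On one probability space let $X=(X_t)_{t\ge 0}$ be a Markov chain with transition matrix $P$ and initial distribution $\pi$, and let $Y=(Y_t)_{t\ge 0}$ be a Markov chain with transition matrix $P$ started in $Y_0=i$; the two chains may be coupled in an arbitrary way. Put $$T_{\pi,i}=\inf\{t\ge 0: X_t=i\},\qquad T_{i,i}=\inf\{t>0: Y_t=i\}.$$ Let $\mathrm{Exp}(1)$ be the exponential distribution with mean $1$, and let $d_{\mathrm K}(Q,R)=\sup_{z\in\mathbb R}|Q((-\infty,z])-R((-\infty,z])|$ be the Kolmogorov distance of probability measures on $\mathbb R$. Then $T_{\pi,i}$ and $T_{i,i}$ are almost surely finite, and $$d_{\mathrm K}\bigl(\mathscr L(\pi_iT_{\pi,i}),\mathrm{Exp}(1)\bigr)\le 1.5\,\pi_i+\pi_i\,\mathbb E|T_{\pi,i}-T_{i,i}|$$ (where the right-hand side may be infinite) and $$d_{\mathrm K}\bigl(\mathscr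 L(\pi_iT_{\pi,i}),\mathrm{Exp}(1)\bigr)\le 2\pi_i+\mathbb P(T_{\pi,i}\ne T_{i,i}).$$ Moreover, if $U$ is uniformly distributed on $[0,1]$ and independent of $T_{\pi,i}$, then $T_{\pi,i}+U$ has the equilibrium distribution with respect to $T_{i,i}$: $T_{i,i}$ has finite mean, the law of $T_{\pi,i}+U$ is absolutely continuous, and for every Lipschitz function $f:\mathbb R\to\mathbb R$ $$\mathbb E f(T_{i,i})-f(0)=\mathbb E T_{i,i}\;\mathbb E f'(T_{\pi,i}+U).$$ -/

import Mathlib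

open MeasureTheory ProbabilityTheory
open scoped ENNReal NNReal

noncomputable section

namespace FirstPassage

/-- The Kolmogorov distance `sup_z |P((-∞, z]) - Q((-∞, z])|` of two probability measures on `ℝ`.
It takes values in `[0, ∞]`, so that the supremum is a genuine one. -/
def kolmogorovDist (P Q : Measure ℝ) : ℝ≥0∞ :=
  ⨆ z : ℝ, ENNReal.ofReal |P.real (Set.Iic z) - Q.real (Set.Iic z)|

/-- `ν` is the equilibrium distribution with respect to the law `ρ` of a nonnegative random
variable `Z` with finite mean: `E f(Z) - f(0) = E Z * E f'(Zᵉ)` for all Lipschitz `f`, where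
`Zᵉ ∼ ν`. A Lipschitz function is differentiable only Lebesgue-almost everywhere; the absolute
continuity of `ν` makes the right-hand side meaningful. -/
structure IsEquilibriumLaw (ρ ν : Measure ℝ) : Prop where
  isProbabilityMeasure : IsProbabilityMeasure ν
  nonneg : ∀ᵐ x ∂ρ, 0 ≤ x
  integrable : Integrable (fun x : ℝ => x) ρ
  absolutelyContinuous : ν ≪ volume
  eq : ∀ (K : ℝ≥0) (f : ℝ → ℝ), LipschitzWith K f →
    (∫ x, f x ∂ρ) - f 0 = (∫ x, x ∂ρ) * ∫ x, deriv f x ∂ν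

variable {S : Type*}

/-- The law after `n` steps of the chain with transition matrix `P` (whose row at `a` is the
probability distribution `P a`) started in `a`. -/
def nStep (P : S → PMF S) : ℕ → S → PMF S
  | 0, a => PMF.pure a
  | n + 1, a => (P a).bind (nStep P n)

/-- Every state can be reached from every state with positive probability. -/
def IsIrreducibleChain (P : S → PMF S) : Prop :=
  ∀ a b : S, ∃ n : ℕ, nStep P n a b ≠ 0

/-- `π` is a stationary distribution: `∑ a, π a * P a b = π b` for all `b`. -/
def IsStationaryLaw (P : S → PMF S) (π : PMF S) : Prop :=
  ∀ b : S, ∑' a, π a * P a b = π b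

/-- Under `μ`, the process `X 0, X 1, …` is a Markov chain with initial distribution `ν` and
transition matrix `P`. -/
structure IsMarkovChain {Ω : Type*} [MeasurableSpace Ω] [MeasurableSpace S] (μ : Measure Ω)
    (X : ℕ → Ω → S) (ν : PMF S) (P : S → PMF S) : Prop where
  measurable : ∀ n, Measurable (X n)
  path_law : ∀ (n : ℕ) (x : ℕ → S),
    μ {ω | ∀ k ≤ n, X k ω = x k} = ν (x 0) * ∏ k ∈ Finset.range n, P (x k) (x (k + 1))

/-- `inf {t ≥ m : X_t = i}`, with the value `∞` if the set is empty. -/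
def hitTime {Ω : Type*} (X : ℕ → Ω → S) (i : S) (m : ℕ) (ω : Ω) : ℕ∞ :=
  hittingAfter X {i} m ω

/-- An almost surely finite time as a real number. -/
def realTime (t : ℕ∞) : ℝ := (t.toNat : ℝ)

end FirstPassage

end

open FirstPassage

/-! Write p = π i, M = T_{π,i}, N = T_{i,i}. By stationarity, avoiding i at times 1, …, n has the
same probability as avoiding it at times 0, …, n - 1. Splitting the first event according to whether
the chain starts in i, and subtracting, gives the only fact about the chains used in the bounds: P(M
= k) = p P(N > k) for all k (`measureReal_hitTime_eq`).

Summing the chain form of this identity (`measure_first_visit`) over k bounds p ∑ P(N > k) by 1, so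
the avoidance probabilities from i tend to 0; irreducibility carries this to every starting state,
and both times are almost surely finite.

Summation by parts turns the law identity into E[f(M + 1) - f(M)] = p (E f(N) - f(0)). The left side
is E f'(M + U), which is the equilibrium relation, the choice f = id giving p E N = 1. Stein's
method takes f = g with g(x) = exp(min(p x - z, 0)), for which g' = p (g - 1_{p x > z}) off the
kink; hence P(p(M + U) ≤ z) - (1 - exp(-z)) = E[g(N) - g(M + U)] for z ≥ 0. Since g is p-Lipschitz
with values in [0, 1], the right side is controlled by |M - N| or by the event M ≠ N. Removing U
costs at most max_k P(M = k) ≤ p. -/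

namespace FirstPassage

/-! ### Avoidance probabilities, stationarity and recurrence -/

section Chain

variable {S : Type*}

/-- The probability that the chain started in `a` does not visit `i` at the times `1, …, n`. -/
noncomputable def avoidProb (P : S → PMF S) (i : S) : ℕ → S → ℝ≥0∞
  | 0, _ => 1
  | n + 1, a => ∑' b, P a b * ({i}ᶜ : Set S).indicator (avoidProb P i n) b

lemma measure_eq_tsum_fiber {Ω : Type*} [MeasurableSpace Ω] [Countable S] [MeasurableSpace S]
    [MeasurableSingletonClass S] (μ : Measure Ω) {X : Ω → S} (hX : Measurable X) (s : Set Ω) :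
    μ s = ∑' b, μ (s ∩ {ω | X ω = b}) := by
  -- Restricting `μ` to `s` and pushing forward along `X` avoids any measurability assumption on
  -- `s`.
  rw [← Measure.restrict_apply_univ, ← lintegral_one,
    ← lintegral_map (μ := μ.restrict s) (f := fun _ : S => 1) measurable_const hX,
    lintegral_countable']
  refine tsum_congr fun b => ?_
  rw [one_mul, Measure.map_apply hX (measurableSet_singleton b),
    Measure.restrict_apply (hX (measurableSet_singleton b)), Set.inter_comm]
  rfl

variable {π : PMF S} {P : S → PMF S}

/-- Time shift by one step: after the first step the chain again has law `π`, and the indicator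
records that it has not landed in `i`. -/
lemma IsStationaryLaw.tsum_avoidProb_succ (h : IsStationaryLaw P π) (i : S) (n : ℕ) :
    ∑' a, π a * avoidProb P i (n + 1) a =
      ∑' a, π a * ({i}ᶜ : Set S).indicator (avoidProb P i n) a := by
  simp_rw [avoidProb, ← ENNReal.tsum_mul_left]
  rw [ENNReal.tsum_comm]
  refine tsum_congr fun b => ?_
  rw [← h b, ← ENNReal.tsum_mul_right]
  exact tsum_congr fun a => (mul_assoc _ _ _).symm

lemma IsIrreducibleChain.induction (h : IsIrreducibleChain P) {p : S → Prop} {a : S} (ha : p a)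
    (hp : ∀ a b, p a → P a b ≠ 0 → p b) (b : S) : p b := by
  obtain ⟨n, hn⟩ := h a b
  induction n generalizing a with
  | zero =>
    simp only [nStep, ne_eq, PMF.pure_apply, ite_eq_right_iff, one_ne_zero, imp_false,
      not_not] at hn
    rwa [hn]
  | succ n ih =>
    simp only [nStep, PMF.bind_apply, ne_eq, ENNReal.tsum_eq_zero, mul_eq_zero, not_forall,
      not_or] at hn
    obtain ⟨c, hc, hn⟩ := hn
    exact ih (hp a c ha hc) hn

lemma IsStationaryLaw.ne_zero (hπ : IsStationaryLaw P π) (h : IsIrreducibleChain P) (i : S) :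
    π i ≠ 0 := by
  obtain ⟨a, ha⟩ := π.support_nonempty
  refine h.induction (p := fun a => π a ≠ 0) ((π.mem_support_iff a).1 ha) ?_ i
  intro a b ha hab
  rw [← hπ b]
  simp only [ne_eq, ENNReal.tsum_eq_zero, mul_eq_zero, not_forall, not_or]
  exact ⟨a, ha, hab⟩

/-- Certain return spreads along edges: if P a b > 0 with b ≠ i, a positive chance of never visiting
`i` from b would give one from a. -/
lemma iInf_avoidProb_eq_zero (hirr : IsIrreducibleChain P) {i : S}
    (hi : ⨅ n, avoidProb P i n i = 0) (a : S) : ⨅ n, avoidProb P i n a = 0 := by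
  refine hirr.induction (p := fun a => ⨅ n, avoidProb P i n a = 0) hi ?_ a
  intro a b ha hab
  by_cases hb : b = i
  · rw [hb]; exact hi
  have hle : P a b * ⨅ n, avoidProb P i n b ≤ ⨅ n, avoidProb P i n a := by
    refine le_iInf fun n => ?_
    cases n with
    | zero =>
      exact mul_le_one' (PMF.coe_le_one _ _) (iInf_le (fun n => avoidProb P i n b) 0)
    | succ n =>
      refine le_trans ?_ (ENNReal.le_tsum b)
      rw [Set.indicator_of_mem (by simpa using hb)]
      gcongr
      exact iInf_le (fun n => avoidProb P i n b) n
  rw [ha, nonpos_iff_eq_zero, mul_eq_zero] at hle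
  exact hle.resolve_left hab

variable [Countable S] [MeasurableSpace S] [MeasurableSingletonClass S]
  {Ω : Type*} [MeasurableSpace Ω] {μ : Measure Ω} {X : ℕ → Ω → S} {ν : PMF S}

/-- The Markov property in the form needed. Induction on `n` for all prescribed initial paths at
once: conditioning on the next state b ≠ i lengthens the path by one and shortens the avoidance
period by one. -/
lemma IsMarkovChain.measure_path_avoid (h : IsMarkovChain μ X ν P) (i : S) (n : ℕ) :
    ∀ (m : ℕ) (x : ℕ → S),
      μ {ω | (∀ k ≤ m, X k ω = x k) ∧ ∀ k, m < k → k ≤ m + n → X k ω ≠ i} =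
        ν (x 0) * (∏ k ∈ Finset.range m, P (x k) (x (k + 1))) * avoidProb P i n (x m) := by
  induction n with
  | zero =>
    intro m x
    rw [avoidProb, mul_one, ← h.path_law]
    congr 1; ext ω
    simp only [Set.mem_ofPred_eq, and_iff_left_iff_imp]
    intros; omega
  | succ n ih =>
    intro m x
    rw [measure_eq_tsum_fiber μ (h.measurable (m + 1)), avoidProb, ← ENNReal.tsum_mul_left]
    refine tsum_congr fun b => ?_
    by_cases hb : b = i
    · subst hb
      simp only [Set.mem_compl_iff, Set.mem_singleton_iff, not_true_eq_false, not_false_eq_true,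
        Set.indicator_of_notMem, mul_zero]
      convert measure_empty (μ := μ)
      ext ω
      simp only [Set.mem_inter_iff, Set.mem_ofPred_eq, Set.mem_empty_iff_false, iff_false]
      rintro ⟨⟨-, h2⟩, h3⟩
      exact h2 (m + 1) (by omega) (by omega) h3
    · rw [Set.indicator_of_mem (by simpa using hb)]
      have := ih (m + 1) (fun k => if k = m + 1 then b else x k)
      rw [Finset.prod_range_succ, Finset.prod_congr rfl (g := fun k => P (x k) (x (k + 1)))] at this
      · simp only [Nat.zero_ne_add_one, ↓reduceIte, (Nat.succ_ne_self m).symm] at this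
        rw [← mul_assoc, mul_assoc (ν (x 0)), ← this]
        congr 1; ext ω
        simp only [Set.mem_inter_iff, Set.mem_ofPred_eq]
        constructor
        · rintro ⟨⟨h1, h2⟩, h3⟩
          refine ⟨fun k hk => ?_, fun k hk hk' => h2 k (by omega) (by omega)⟩
          split_ifs with hkm
          · rw [hkm, h3]
          · exact h1 k (by omega)
        · rintro ⟨h1, h2⟩
          have h3 : X (m + 1) ω = b := by simpa using h1 (m + 1) le_rfl
          refine ⟨⟨fun k hk => ?_, fun k hk hk' => ?_⟩, h3⟩
          · have := h1 k (by omega)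
            rwa [if_neg (by omega)] at this
          · rcases eq_or_ne k (m + 1) with rfl | hkm
            · rwa [h3]
            · exact h2 k (by omega) (by omega)
      · intro k hk
        have := Finset.mem_range.1 hk
        rw [if_neg (by omega), if_neg (by omega)]

lemma IsMarkovChain.measure_start_avoid (h : IsMarkovChain μ X ν P) (i a : S) (n : ℕ) :
    μ {ω | X 0 ω = a ∧ ∀ k, 0 < k → k ≤ n → X k ω ≠ i} = ν a * avoidProb P i n a := by
  simpa using h.measure_path_avoid i n 0 (fun _ => a)

/-- The chain with initial law `ν` avoids `i` at the times `1, …, n`. -/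
lemma IsMarkovChain.measure_avoid (h : IsMarkovChain μ X ν P) (i : S) (n : ℕ) :
    μ {ω | ∀ k, 0 < k → k ≤ n → X k ω ≠ i} = ∑' a, ν a * avoidProb P i n a := by
  rw [measure_eq_tsum_fiber μ (h.measurable 0)]
  refine tsum_congr fun a => ?_
  rw [← h.measure_start_avoid]
  congr 1; ext ω; simp [and_comm]

lemma IsMarkovChain.measure_avoid_pure {i : S} (h : IsMarkovChain μ X (PMF.pure i) P) (n : ℕ) :
    μ {ω | ∀ k, 0 < k → k ≤ n → X k ω ≠ i} = avoidProb P i n i := by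
  rw [h.measure_avoid, tsum_eq_single i]
  · simp
  · intro b hb; simp [hb]

lemma IsMarkovChain.measure_avoid_zero (h : IsMarkovChain μ X ν P) (i : S) (n : ℕ) :
    μ {ω | ∀ k < n + 1, X k ω ≠ i} =
      ∑' a, ν a * ({i}ᶜ : Set S).indicator (avoidProb P i n) a := by
  rw [measure_eq_tsum_fiber μ (h.measurable 0)]
  refine tsum_congr fun a => ?_
  by_cases ha : a = i
  · subst ha
    simp only [Set.mem_compl_iff, Set.mem_singleton_iff, not_true_eq_false, not_false_eq_true,
        Set.indicator_of_notMem, mul_zero]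
    convert measure_empty (μ := μ)
    ext ω
    simp only [Set.mem_inter_iff, Set.mem_ofPred_eq, Set.mem_empty_iff_false, iff_false]
    rintro ⟨h2, h3⟩
    exact h2 0 (by omega) h3
  · rw [Set.indicator_of_mem (by simpa using ha), ← h.measure_start_avoid]
    congr 1; ext ω
    simp only [Set.mem_inter_iff, Set.mem_ofPred_eq]
    constructor
    · rintro ⟨h1, h2⟩
      exact ⟨h2, fun k _ hk => h1 k (by omega)⟩
    · rintro ⟨h1, h2⟩
      refine ⟨fun k hk => ?_, h1⟩
      rcases Nat.eq_zero_or_pos k with rfl | hk0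
      · rwa [h1]
      · exact h2 k hk0 (by omega)

/-- The probability that the stationary chain avoids `i` at the times `0, …, n - 1`. -/
lemma IsMarkovChain.measure_avoid_stationary [IsProbabilityMeasure μ] (h : IsMarkovChain μ X π P)
    (hπ : IsStationaryLaw P π) (i : S) (n : ℕ) :
    μ {ω | ∀ k < n, X k ω ≠ i} = ∑' a, π a * avoidProb P i n a := by
  cases n with
  | zero => simp [avoidProb, PMF.tsum_coe]
  | succ n => rw [h.measure_avoid_zero, hπ.tsum_avoidProb_succ]

/-- Both sides compute the probability of avoiding `i` at times 1, …, n: on the left it is split by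
whether the start is `i`, on the right it is shifted by stationarity. -/
lemma IsMarkovChain.measure_first_visit_add [IsProbabilityMeasure μ] (h : IsMarkovChain μ X π P)
    (hπ : IsStationaryLaw P π) (i : S) (n : ℕ) :
    π i * avoidProb P i n i + μ {ω | ∀ k < n + 1, X k ω ≠ i} = μ {ω | ∀ k < n, X k ω ≠ i} := by
  classical
  rw [h.measure_avoid_stationary hπ i n, h.measure_avoid_zero,
    ENNReal.tsum_eq_add_tsum_ite (f := fun a => π a * avoidProb P i n a) i]
  congr 1
  refine tsum_congr fun a => ?_
  by_cases ha : a = i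
  · simp [ha]
  · rw [if_neg ha, Set.indicator_of_mem (by simpa using ha)]

/-- The stationary chain first visits `i` at time `n` with probability `π i * P_i(T_i > n)`. -/
lemma IsMarkovChain.measure_first_visit [IsProbabilityMeasure μ] (h : IsMarkovChain μ X π P)
    (hπ : IsStationaryLaw P π) (i : S) (n : ℕ) :
    μ {ω | (∀ k < n, X k ω ≠ i) ∧ X n ω = i} = π i * avoidProb P i n i := by
  have hadd := h.measure_first_visit_add hπ i n
  have hm : MeasurableSet {ω | X n ω = i} := h.measurable n (measurableSet_singleton i)
  rw [← measure_inter_add_sdiff {ω | ∀ k < n, X k ω ≠ i} hm] at hadd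
  have heq : {ω | ∀ k < n, X k ω ≠ i} \ {ω | X n ω = i} = {ω | ∀ k < n + 1, X k ω ≠ i} := by
    ext ω
    simp only [Set.mem_sdiff, Set.mem_ofPred_eq, Nat.forall_lt_succ_right]
  rw [heq] at hadd
  exact ((ENNReal.add_left_inj (measure_ne_top μ _)).1 hadd).symm

/-- Positive recurrence: first visits at different times are disjoint events, so their probabilities
`π i * avoidProb P i n i` sum to at most 1, and `π i` is nonzero. -/
lemma IsMarkovChain.tsum_avoidProb_ne_top [IsProbabilityMeasure μ] (h : IsMarkovChain μ X π P)
    (hπ : IsStationaryLaw P π) (hirr : IsIrreducibleChain P) (i : S) :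
    ∑' n, avoidProb P i n i ≠ ∞ := by
  have hle : π i * ∑' n, avoidProb P i n i ≤ 1 := by
    rw [← ENNReal.tsum_mul_left]
    simp_rw [← h.measure_first_visit hπ i]
    rw [← measure_iUnion]
    · exact prob_le_one
    · refine fun m n hmn => Set.disjoint_left.2 fun ω hm hn => ?_
      rcases lt_or_gt_of_ne hmn with hlt | hlt
      · exact hn.1 m hlt hm.2
      · exact hm.1 n hlt hn.2
    · intro n
      have : {ω | (∀ k < n, X k ω ≠ i) ∧ X n ω = i} =
          (⋂ k, ⋂ _ : k < n, {ω | X k ω = i}ᶜ) ∩ {ω | X n ω = i} := by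
        ext ω; simp
      rw [this]
      have hm (k : ℕ) : MeasurableSet {ω | X k ω = i} := h.measurable k (measurableSet_singleton i)
      exact (MeasurableSet.iInter fun k => MeasurableSet.iInter fun _ => (hm k).compl).inter (hm n)
  intro htop
  rw [htop, ENNReal.mul_top (hπ.ne_zero hirr i)] at hle
  simp at hle

lemma IsMarkovChain.iInf_avoidProb_eq_zero [IsProbabilityMeasure μ] (h : IsMarkovChain μ X π P)
    (hπ : IsStationaryLaw P π) (hirr : IsIrreducibleChain P) (i a : S) :
    ⨅ n, avoidProb P i n a = 0 := by
  refine FirstPassage.iInf_avoidProb_eq_zero hirr ?_ a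
  have ht := ENNReal.tendsto_atTop_zero_of_tsum_ne_top (h.tsum_avoidProb_ne_top hπ hirr i)
  exact nonpos_iff_eq_zero.1 (ge_of_tendsto' ht fun n => iInf_le _ n)

/-- A chain returns to `i` almost surely if the avoidance probabilities tend to zero. -/
lemma IsMarkovChain.ae_exists_visit (h : IsMarkovChain μ X ν P) {i : S}
    (hz : ∀ a, ⨅ n, avoidProb P i n a = 0) : ∀ᵐ ω ∂μ, ∃ n, 0 < n ∧ X n ω = i := by
  have hsub : {ω | ¬ ∃ n, 0 < n ∧ X n ω = i} ⊆
      ⋃ a, {ω | X 0 ω = a ∧ ∀ k, 0 < k → X k ω ≠ i} := by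
    intro ω hω
    simp only [Set.mem_ofPred_eq, not_exists, not_and] at hω
    exact Set.mem_iUnion.2 ⟨X 0 ω, rfl, hω⟩
  refine measure_mono_null hsub (measure_iUnion_null fun a => ?_)
  refine nonpos_iff_eq_zero.1 ((?_ : _ ≤ ⨅ n, ν a * avoidProb P i n a).trans_eq ?_)
  · refine le_iInf fun n => ?_
    rw [← h.measure_start_avoid]
    exact measure_mono fun ω hω => ⟨hω.1, fun k hk _ => hω.2 k hk⟩
  · rw [← ENNReal.mul_iInf (by simp [PMF.apply_ne_top]), hz, mul_zero]

end Chain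

/-! ### Hitting times as extended natural numbers -/

section HitTime

variable {S Ω : Type*} {X : ℕ → Ω → S} {i : S} {m n : ℕ} {ω : Ω}

lemma hitTime_le_iff : hitTime X i m ω ≤ n ↔ ∃ j, m ≤ j ∧ j ≤ n ∧ X j ω = i := by
  refine (hittingAfter_le_iff (u := X) (s := {i}) (n := m) (i := n)).trans ?_
  simp [and_assoc]

lemma hitTime_ne_top_iff : hitTime X i m ω ≠ ⊤ ↔ ∃ j, m ≤ j ∧ X j ω = i := by
  refine (not_congr (hittingAfter_eq_top_iff (u := X) (s := {i}) (n := m))).trans ?_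
  simp

lemma lt_hitTime_iff : (n : ℕ∞) < hitTime X i m ω ↔ ∀ j, m ≤ j → j ≤ n → X j ω ≠ i := by
  rw [← not_le, hitTime_le_iff]
  push Not
  rfl

lemma hitTime_zero_eq_iff : hitTime X i 0 ω = n ↔ (∀ k < n, X k ω ≠ i) ∧ X n ω = i := by
  constructor
  · intro h
    have hlt (k : ℕ) (hk : k < n) : X k ω ≠ i :=
      lt_hitTime_iff.1 (h ▸ Nat.cast_lt.2 hk : (k : ℕ∞) < hitTime X i 0 ω) k (Nat.zero_le k) le_rfl
    obtain ⟨j, -, hj, hji⟩ := hitTime_le_iff.1 h.le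
    rcases hj.lt_or_eq with hjn | rfl
    · exact absurd hji (hlt j hjn)
    · exact ⟨hlt, hji⟩
  · rintro ⟨h1, h2⟩
    refine le_antisymm (hitTime_le_iff.2 ⟨n, Nat.zero_le n, le_rfl, h2⟩) (le_of_not_gt fun hlt => ?_)
    obtain ⟨k, hk⟩ := ENat.ne_top_iff_exists.1 hlt.ne_top
    rw [← hk, Nat.cast_lt] at hlt
    obtain ⟨j, -, hj, hji⟩ := hitTime_le_iff.1 hk.ge
    exact h1 j (by omega) hji

lemma measurable_toNat_hitTime [MeasurableSpace Ω] [MeasurableSpace S]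
    [MeasurableSingletonClass S] (hX : ∀ n, Measurable (X n)) :
    Measurable fun ω => (hitTime X i m ω).toNat := by
  have hle (n : ℕ) : MeasurableSet {ω | hitTime X i m ω ≤ n} := by
    have : {ω | hitTime X i m ω ≤ n} = ⋃ j, ⋃ _ : m ≤ j ∧ j ≤ n, {ω | X j ω = i} := by
      ext ω; simp [hitTime_le_iff, and_assoc]
    rw [this]
    exact MeasurableSet.iUnion fun j => MeasurableSet.iUnion fun _ =>
      hX j (measurableSet_singleton i)
  refine measurable_of_Iic fun n => ?_
  -- `ENat.toNat` sends ⊤ to 0, so the event of never hitting belongs to every such preimage.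
  have : (fun ω => (hitTime X i m ω).toNat) ⁻¹' Set.Iic n =
      {ω | hitTime X i m ω ≤ n} ∪ ⋂ k : ℕ, {ω | hitTime X i m ω ≤ k}ᶜ := by
    ext ω
    simp only [Set.mem_preimage, Set.mem_Iic, Set.mem_union, Set.mem_ofPred_eq, Set.mem_iInter,
      Set.mem_compl_iff]
    rcases eq_or_ne (hitTime X i m ω) ⊤ with h | h
    · simp [h]
    · obtain ⟨k, hk⟩ := ENat.ne_top_iff_exists.1 h
      rw [← hk]
      simp only [ENat.toNat_natCast, Nat.cast_le]
      exact ⟨Or.inl, fun h => h.resolve_right fun h' => h' k le_rfl⟩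
  rw [this]
  exact (hle n).union (MeasurableSet.iInter fun k => (hle k).compl)

end HitTime

/-! ### The equilibrium distribution of a natural-valued variable -/

section Equilibrium

/-- The product of `μ` and the uniform distribution on `[0, 1]`. -/
noncomputable abbrev smoothedMeasure {Ω : Type*} [MeasurableSpace Ω] (μ : Measure Ω) : Measure (Ω × ℝ) :=
  μ.prod (volume.restrict (Set.Icc (0 : ℝ) 1))

lemma smoothed_absolutelyContinuous {Ω : Type*} [MeasurableSpace Ω] {μ : Measure Ω} {M : Ω → ℕ}
    (hM : Measurable M) :
    (smoothedMeasure μ).map (fun q => (M q.1 : ℝ) + q.2) ≪ volume := by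
  have hm : Measurable fun q : Ω × ℝ => (M q.1 : ℝ) + q.2 := by fun_prop
  refine Measure.AbsolutelyContinuous.mk fun s hs h0 => ?_
  rw [Measure.map_apply hm hs, Measure.measure_prod_null (hm hs)]
  refine Filter.Eventually.of_forall fun ω => ?_
  refine le_antisymm ((Measure.restrict_apply_le _ _).trans_eq ?_) (zero_le)
  have : Prod.mk ω ⁻¹' ((fun q : Ω × ℝ => (M q.1 : ℝ) + q.2) ⁻¹' s) = (fun x => (M ω : ℝ) + x) ⁻¹' s :=
    rfl
  rw [this, measure_preimage_add, h0]
  rfl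

variable {Ω : Type*} [MeasurableSpace Ω] {μ : Measure Ω} [IsProbabilityMeasure μ] {M N : Ω → ℕ}
  {p : ℝ}

lemma hasSum_integral_comp_nat (hM : Measurable M) {d : ℕ → ℝ} {C : ℝ} (hd : ∀ k, |d k| ≤ C) :
    HasSum (fun k => μ.real {ω | M ω = k} * d k) (∫ ω, d (M ω) ∂μ) := by
  have : IsProbabilityMeasure (μ.map M) := Measure.isProbabilityMeasure_map hM.aemeasurable
  rw [← integral_map hM.aemeasurable (f := d) (by fun_prop)]
  have hint : Integrable d (μ.map M) :=
    Integrable.of_bound (by fun_prop) C (Filter.Eventually.of_forall hd)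
  have h := hasSum_integral_iUnion (μ := μ.map M) (f := d) (s := fun k : ℕ => {k})
    (fun k => measurableSet_singleton k) (fun a b hab => by simpa using hab) hint.integrableOn
  simp only [Set.iUnion_of_singleton, Measure.restrict_univ, integral_singleton, smul_eq_mul] at h
  have hk (k : ℕ) : (μ.map M).real {k} = μ.real {ω | M ω = k} :=
    map_measureReal_apply hM (measurableSet_singleton k)
  simpa only [hk] using h

lemma hasSum_measureReal_eq (hM : Measurable M) : HasSum (fun k => μ.real {ω | M ω = k}) 1 := by
  simpa using hasSum_integral_comp_nat (μ := μ) hM (d := fun _ => 1) (C := 1) (by simp)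

/-- A natural-valued variable with summable tail probabilities is integrable. -/
lemma integrable_natCast_of_summable (hN : Measurable N)
    (hs : Summable fun k : ℕ => μ.real {ω | k < N ω}) : Integrable (fun ω => (N ω : ℝ)) μ := by
  have hm (k : ℕ) : MeasurableSet {ω | k < N ω} := hN measurableSet_Ioi
  have hNe (ω : Ω) : (N ω : ℝ≥0∞) = ∑' k : ℕ, {ω | k < N ω}.indicator 1 ω := by
    rw [tsum_eq_sum (s := Finset.range (N ω))]
    · rw [Finset.sum_congr rfl (g := fun _ => 1)]
      · simp
      · intro k hk
        exact Set.indicator_of_mem (s := {ω | k < N ω}) (Finset.mem_range.1 hk) 1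
    · intro k hk
      exact Set.indicator_of_notMem (s := {ω | k < N ω}) (fun h => hk (Finset.mem_range.2 h)) 1
  refine ⟨by fun_prop, ?_⟩
  rw [hasFiniteIntegral_iff_enorm]
  have : ∀ ω, ‖(N ω : ℝ)‖ₑ = ∑' k : ℕ, {ω | k < N ω}.indicator 1 ω := by
    intro ω; rw [← hNe]; simp [enorm]
  simp_rw [this]
  rw [lintegral_tsum fun k => (measurable_one.indicator (hm k)).aemeasurable]
  simp_rw [lintegral_indicator_one (hm _)]
  have hs' := hs.tsum_ofReal_lt_top
  simpa [ofReal_measureReal] using hs'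

lemma integrable_comp_nat (hNi : Integrable (fun ω => (N ω : ℝ)) μ) (hN : Measurable N)
    {g : ℝ → ℝ} {K : ℝ≥0} (hg : LipschitzWith K g) : Integrable (fun ω => g (N ω)) μ := by
  refine ((hNi.const_mul (K : ℝ)).add (integrable_const |g 0|)).mono'
    (by have := hg.continuous; fun_prop) (Filter.Eventually.of_forall fun ω => ?_)
  have h := hg.dist_le_mul (N ω) 0
  rw [Real.dist_eq, Real.dist_eq, sub_zero, abs_of_nonneg (Nat.cast_nonneg (α := ℝ) (N ω))] at h
  have h2 := abs_sub_abs_le_abs_sub (g (N ω)) (g 0)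
  simp only [Real.norm_eq_abs, Pi.add_apply]
  linarith

/-- Summation by parts for the expectation of a function of a natural-valued variable. -/
lemma hasSum_integral_sub (hN : Measurable N)
    (hs : Summable fun k : ℕ => μ.real {ω | k < N ω}) {g : ℕ → ℝ} {C : ℝ}
    (hg : ∀ k, |g (k + 1) - g k| ≤ C) :
    HasSum (fun k : ℕ => μ.real {ω | k < N ω} * (g (k + 1) - g k)) (∫ ω, (g (N ω) - g 0) ∂μ) := by
  have hm (k : ℕ) : MeasurableSet {ω | k < N ω} := hN measurableSet_Ioi
  have h := hasSum_integral_of_summable_integral_norm (μ := μ)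
    (F := fun (k : ℕ) ω => {ω | k < N ω}.indicator (fun _ => g (k + 1) - g k) ω)
    (fun k => (integrable_const _).indicator (hm k)) ?_
  · simp_rw [integral_indicator_const _ (hm _), smul_eq_mul] at h
    have hsum (ω : Ω) : ∑' k : ℕ, {ω | k < N ω}.indicator (fun _ => g (k + 1) - g k) ω =
        g (N ω) - g 0 := by
      rw [tsum_eq_sum (s := Finset.range (N ω)), ← Finset.sum_range_sub]
      · refine Finset.sum_congr rfl fun k hk => ?_
        exact Set.indicator_of_mem (s := {ω | k < N ω}) (Finset.mem_range.1 hk) _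
      · intro k hk
        exact Set.indicator_of_notMem (s := {ω | k < N ω}) (fun h => hk (Finset.mem_range.2 h)) _
    simpa only [hsum] using h
  · simp_rw [norm_indicator_eq_indicator_norm, integral_indicator_const _ (hm _), smul_eq_mul]
    exact (hs.mul_right C).of_nonneg_of_le (fun k => by positivity)
      (fun k => mul_le_mul_of_nonneg_left (hg k) measureReal_nonneg)

lemma summable_of_law (hM : Measurable M) (hp : 0 < p)
    (hlaw : ∀ k : ℕ, μ.real {ω | M ω = k} = p * μ.real {ω | k < N ω}) :
    Summable fun k : ℕ => μ.real {ω | k < N ω} := by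
  have h := (hasSum_measureReal_eq (μ := μ) hM).summable
  simp_rw [hlaw] at h
  exact (summable_mul_left_iff hp.ne').1 h

/-- Discrete equilibrium relation: weighting the increments of `f` by P(M = k) = p P(N > k) and
summing by parts telescopes to `f (N) - f 0`. -/
lemma integral_increment (hM : Measurable M) (hN : Measurable N) (hp : 0 < p)
    (hlaw : ∀ k : ℕ, μ.real {ω | M ω = k} = p * μ.real {ω | k < N ω}) {f : ℝ → ℝ} {K : ℝ≥0}
    (hf : LipschitzWith K f) :
    ∫ ω, (f (M ω + 1) - f (M ω)) ∂μ = p * ((∫ ω, f (N ω) ∂μ) - f 0) := by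
  have hs := summable_of_law hM hp hlaw
  have hb (k : ℕ) : |f (k + 1) - f k| ≤ K := by
    simpa [Real.dist_eq] using hf.dist_le_mul ((k : ℝ) + 1) k
  have h1 := hasSum_integral_comp_nat (μ := μ) hM (d := fun k => f (k + 1) - f k) hb
  have h2 := (hasSum_integral_sub hN hs (g := fun k => f k) (C := K)
    (fun k => by simpa using hb k)).mul_left p
  simp_rw [hlaw, mul_assoc] at h1
  push_cast at h2
  rw [h1.unique h2, integral_sub (integrable_comp_nat (integrable_natCast_of_summable hN hs) hN hf)
    (integrable_const _)]
  simp

instance isProbabilityMeasure_uniform :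
    IsProbabilityMeasure (volume.restrict (Set.Icc (0 : ℝ) 1)) := ⟨by simp⟩

/-- Integrating out the uniform variable first is the fundamental theorem of calculus on [M, M + 1],
valid since a Lipschitz function is absolutely continuous. -/
lemma integral_smoothed_deriv (hM : Measurable M) {f : ℝ → ℝ} {K : ℝ≥0} (hf : LipschitzWith K f) :
    ∫ q, deriv f (M q.1 + q.2) ∂(smoothedMeasure μ) = ∫ ω, (f (M ω + 1) - f (M ω)) ∂μ := by
  have hd := measurable_deriv f
  rw [integral_prod]
  · refine integral_congr_ae (Filter.Eventually.of_forall fun ω => ?_)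
    simp only
    rw [integral_Icc_eq_integral_Ioc, ← intervalIntegral.integral_of_le zero_le_one,
      intervalIntegral.integral_comp_add_left (fun x => deriv f x), add_zero]
    exact (hf.lipschitzOnWith.absolutelyContinuousOnInterval).integral_deriv_eq_sub
  · refine Integrable.of_bound (hd.comp (by fun_prop)).aestronglyMeasurable (K : ℝ) (Filter.Eventually.of_forall fun q => ?_)
    exact norm_deriv_le_of_lipschitz hf

theorem isEquilibriumLaw_of_law (hM : Measurable M) (hN : Measurable N) (hp : 0 < p)
    (hlaw : ∀ k : ℕ, μ.real {ω | M ω = k} = p * μ.real {ω | k < N ω}) :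
    IsEquilibriumLaw (μ.map fun ω => (N ω : ℝ))
      ((smoothedMeasure μ).map fun q => (M q.1 : ℝ) + q.2) := by
  have hm : Measurable fun q : Ω × ℝ => (M q.1 : ℝ) + q.2 := by fun_prop
  have hNm : Measurable fun ω => (N ω : ℝ) := by fun_prop
  have hNi := integrable_natCast_of_summable hN (summable_of_law hM hp hlaw)
  -- The identity function has increment 1, which identifies the mean of `N` as 1 / p.
  have hmean : p * ∫ ω, (N ω : ℝ) ∂μ = 1 := by
    simpa using (integral_increment hM hN hp hlaw LipschitzWith.id).symm
  refine ⟨Measure.isProbabilityMeasure_map hm.aemeasurable, ?_, ?_,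
    smoothed_absolutelyContinuous hM, fun K f hf => ?_⟩
  · exact (ae_map_iff hNm.aemeasurable measurableSet_Ici).2
      (Filter.Eventually.of_forall fun ω => Nat.cast_nonneg _)
  · exact (integrable_map_measure (by fun_prop) hNm.aemeasurable).2 hNi
  · rw [integral_map hNm.aemeasurable hf.continuous.aestronglyMeasurable,
      integral_map hNm.aemeasurable (by fun_prop),
      integral_map hm.aemeasurable (measurable_deriv f).aestronglyMeasurable,
      integral_smoothed_deriv hM hf, integral_increment hM hN hp hlaw hf, ← mul_assoc,
      mul_comm _ p, hmean, one_mul]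

end Equilibrium

/-! ### Stein's method for the exponential law -/

section Stein

/-- Up to an additive constant, the solution of the Stein equation `f' - f = 1_{(-∞, z]} - c` for
the exponential law, in the scale `p`. -/
noncomputable def steinFun (p z x : ℝ) : ℝ := Real.exp (min (p * x - z) 0)

lemma steinFun_nonneg (p z x : ℝ) : 0 ≤ steinFun p z x := (Real.exp_pos _).le

lemma steinFun_le_one (p z x : ℝ) : steinFun p z x ≤ 1 := Real.exp_le_one_iff.2 (min_le_right _ _)

lemma steinFun_zero {z : ℝ} (p : ℝ) (hz : 0 ≤ z) : steinFun p z 0 = Real.exp (-z) := by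
  simp [steinFun, hz]

lemma abs_exp_sub_exp_le {a b : ℝ} (ha : a ≤ 0) (hb : b ≤ 0) :
    |Real.exp a - Real.exp b| ≤ |a - b| := by
  wlog hab : a ≤ b generalizing a b
  · rw [abs_sub_comm, abs_sub_comm a]; exact this hb ha (le_of_not_ge hab)
  rw [abs_sub_comm, abs_sub_comm a, abs_of_nonneg (sub_nonneg.2 (Real.exp_le_exp.2 hab)),
    abs_of_nonneg (sub_nonneg.2 hab)]
  have h1 : Real.exp a = Real.exp b * Real.exp (a - b) := by rw [← Real.exp_add]; ring_nf
  have h2 := Real.add_one_le_exp (a - b)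
  have h3 := Real.exp_le_one_iff.2 hb
  have h4 := Real.exp_pos b
  nlinarith [mul_le_mul_of_nonneg_left h2 h4.le, mul_le_mul_of_nonneg_right h3 (sub_nonneg.2 hab)]

lemma abs_steinFun_sub_le {p : ℝ} (hp : 0 ≤ p) (z x y : ℝ) :
    |steinFun p z x - steinFun p z y| ≤ p * |x - y| := by
  refine (abs_exp_sub_exp_le (min_le_right _ _) (min_le_right _ _)).trans ?_
  refine (abs_min_sub_min_le_max _ _ _ _).trans ?_
  rw [sub_self, abs_zero, max_eq_left (abs_nonneg _), sub_sub_sub_cancel_right, ← mul_sub, abs_mul,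
    abs_of_nonneg hp]

lemma steinFun_lipschitz {p : ℝ} (hp : 0 ≤ p) (z : ℝ) :
    LipschitzWith p.toNNReal (steinFun p z) :=
  LipschitzWith.of_dist_le_mul fun x y => by
    simpa [Real.dist_eq, Real.coe_toNNReal p hp] using abs_steinFun_sub_le hp z x y

lemma deriv_steinFun {p z x : ℝ} (h : p * x ≠ z) :
    deriv (steinFun p z) x = p * (steinFun p z x - Set.indicator {x | z < p * x} 1 x) := by
  rcases lt_or_gt_of_ne h with h | h
  · have he : steinFun p z =ᶠ[nhds x] fun x => Real.exp (p * x - z) := by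
      have : ∀ᶠ y in nhds x, p * y < z :=
        (continuous_const.mul continuous_id).continuousAt.eventually_lt continuousAt_const h
      filter_upwards [this] with y hy
      rw [steinFun, min_eq_left (by linarith)]
    rw [he.deriv_eq, he.eq_of_nhds, Set.indicator_of_notMem (by simpa using h.le), sub_zero]
    have hd : HasDerivAt (fun x => Real.exp (p * x - z)) (Real.exp (p * x - z) * (p * 1)) x :=
      (((hasDerivAt_id x).const_mul p).sub_const z).exp
    rw [hd.deriv]; ring
  · have he : steinFun p z =ᶠ[nhds x] fun _ => 1 := by
      have : ∀ᶠ y in nhds x, z < p * y :=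
        continuousAt_const.eventually_lt (continuous_const.mul continuous_id).continuousAt h
      filter_upwards [this] with y hy
      rw [steinFun, min_eq_right (by linarith), Real.exp_zero]
    rw [he.deriv_eq, he.eq_of_nhds, Set.indicator_of_mem (by exact h)]
    simp

lemma ae_smoothed_mem_Icc {Ω : Type*} [MeasurableSpace Ω] {μ : Measure Ω} :
    ∀ᵐ q ∂(smoothedMeasure μ), q.2 ∈ Set.Icc (0 : ℝ) 1 :=
  Measure.ae_prod_mem_iff_ae_ae_mem (measurable_snd measurableSet_Icc) |>.2
    (Filter.Eventually.of_forall fun _ => ae_restrict_mem measurableSet_Icc)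

variable {Ω : Type*} [MeasurableSpace Ω] {μ : Measure Ω} [IsProbabilityMeasure μ] {M N : Ω → ℕ}
  {p : ℝ}

/-- Stein's identity for a coupling of `N` with its equilibrium version `M + U`. -/
lemma smoothed_sub_exp_eq (hM : Measurable M) (hN : Measurable N) (hp : 0 < p)
    (hlaw : ∀ k : ℕ, μ.real {ω | M ω = k} = p * μ.real {ω | k < N ω}) {z : ℝ} (hz : 0 ≤ z) :
    (smoothedMeasure μ).real {q | p * (M q.1 + q.2) ≤ z} - (1 - Real.exp (-z)) =
      ∫ q, (steinFun p z (N q.1) - steinFun p z (M q.1 + q.2)) ∂(smoothedMeasure μ) := by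
  have hc : Measurable (steinFun p z) := (steinFun_lipschitz hp.le z).continuous.measurable
  have hm : Measurable fun q : Ω × ℝ => (M q.1 : ℝ) + q.2 := by fun_prop
  have hbd (x : ℝ) : ‖steinFun p z x‖ ≤ 1 := by
    rw [Real.norm_eq_abs, abs_of_nonneg (steinFun_nonneg p z x)]; exact steinFun_le_one p z x
  have hi1 : Integrable (fun q : Ω × ℝ => steinFun p z (N q.1)) (smoothedMeasure μ) :=
    Integrable.of_bound (hc.comp (by fun_prop)).aestronglyMeasurable 1 (Filter.Eventually.of_forall fun q => hbd _)
  have hi2 : Integrable (fun q : Ω × ℝ => steinFun p z (M q.1 + q.2)) (smoothedMeasure μ) :=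
    Integrable.of_bound (hc.comp (by fun_prop)).aestronglyMeasurable 1 (Filter.Eventually.of_forall fun q => hbd _)
  have hA : MeasurableSet {q : Ω × ℝ | p * (M q.1 + q.2) ≤ z} :=
    measurableSet_le (by fun_prop) measurable_const
  have hae : ∀ᵐ q ∂(smoothedMeasure μ), deriv (steinFun p z) (M q.1 + q.2) =
      p * (steinFun p z (M q.1 + q.2) - {q : Ω × ℝ | p * (M q.1 + q.2) ≤ z}ᶜ.indicator 1 q) := by
    -- The kink of `steinFun` is a single point, hence null for the absolutely continuous law of M +
    -- U.
    have h0 : ∀ᵐ x ∂((smoothedMeasure μ).map fun q => (M q.1 : ℝ) + q.2), x ≠ z / p :=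
      (smoothed_absolutelyContinuous hM).ae_le (Measure.ae_ne volume _)
    filter_upwards [ae_of_ae_map hm.aemeasurable h0] with q hq
    rw [deriv_steinFun fun h => hq (by rw [← h]; field_simp)]
    congr 2
    simp [Set.indicator]
  have hi3 : Integrable ({q : Ω × ℝ | p * (M q.1 + q.2) ≤ z}ᶜ.indicator (1 : Ω × ℝ → ℝ))
      (smoothedMeasure μ) := (integrable_const 1).indicator hA.compl
  have h1 := integral_increment hM hN hp hlaw (steinFun_lipschitz hp.le z)
  rw [← integral_smoothed_deriv hM (steinFun_lipschitz hp.le z), integral_congr_ae hae,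
    integral_const_mul, integral_sub hi2 hi3,
    integral_indicator_one hA.compl, probReal_compl_eq_one_sub hA, steinFun_zero p hz] at h1
  have h2 := mul_left_cancel₀ hp.ne' h1
  have h3 : ∫ q, steinFun p z (N q.1) ∂(smoothedMeasure μ) = ∫ ω, steinFun p z (N ω) ∂μ := by
    simp [integral_fun_fst (f := fun ω => steinFun p z (N ω))]
  rw [integral_sub hi1 hi2, h3]
  linarith

/-- Since 0 ≤ U ≤ 1, the two events differ only when p M ≤ z < p (M + U), which forces M = ⌊z / p⌋:
a single value, of probability at most p. -/
lemma abs_measureReal_sub_smoothed_le (hM : Measurable M) (hp : 0 < p)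
    (hmax : ∀ k : ℕ, μ.real {ω | M ω = k} ≤ p) (z : ℝ) :
    |μ.real {ω | p * M ω ≤ z} - (smoothedMeasure μ).real {q | p * (M q.1 + q.2) ≤ z}| ≤ p := by
  have hfst (s : Set Ω) : μ.real s = (smoothedMeasure μ).real (Prod.fst ⁻¹' s) := by
    rw [← Set.prod_univ, measureReal_prod_prod]; simp
  have hA : MeasurableSet {q : Ω × ℝ | p * (M q.1 + q.2) ≤ z} :=
    measurableSet_le (by fun_prop) measurable_const
  have hae := ae_smoothed_mem_Icc (μ := μ)
  have h1 : (smoothedMeasure μ).real {q | p * (M q.1 + q.2) ≤ z} ≤ μ.real {ω | p * M ω ≤ z} := by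
    rw [hfst]
    refine ENNReal.toReal_mono (measure_ne_top _ _) (measure_mono_ae ?_)
    filter_upwards [hae] with q hq (h : _ ≤ z)
    change p * (M q.1 : ℝ) ≤ z
    nlinarith [hq.1]
  have h2 : μ.real {ω | p * M ω ≤ z} ≤ (smoothedMeasure μ).real {q | p * (M q.1 + q.2) ≤ z} + p := by
    have h3 := (hfst _).symm.trans_le (hmax ⌊z / p⌋₊)
    refine le_trans ?_ (add_le_add_right h3 _)
    refine le_trans ?_ (measureReal_union_le _ _)
    rw [hfst]
    refine ENNReal.toReal_mono (measure_ne_top _ _) (measure_mono_ae ?_)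
    filter_upwards [hae] with q hq (h : _ ≤ z)
    by_cases hq' : p * (M q.1 + q.2) ≤ z
    · exact Or.inl hq'
    · right
      change M q.1 = ⌊z / p⌋₊
      symm
      rw [Nat.floor_eq_iff (div_nonneg ((by positivity : 0 ≤ p * (M q.1 : ℝ)).trans h) hp.le),
        le_div_iff₀ hp, div_lt_iff₀ hp]
      push Not at hq'
      exact ⟨by linarith, by nlinarith [hq.2]⟩
  rw [abs_sub_le_iff]
  constructor <;> linarith

/-- A bound on the coupling difference gives a bound on the distance to the exponential law. -/
lemma kolmogorovDist_exp_le (hM : Measurable M) (hN : Measurable N) (hp : 0 < p)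
    (hlaw : ∀ k : ℕ, μ.real {ω | M ω = k} = p * μ.real {ω | k < N ω}) {D : Ω × ℝ → ℝ}
    (hD : Integrable D (smoothedMeasure μ))
    (hle : ∀ z, ∀ᵐ q ∂(smoothedMeasure μ),
      |steinFun p z (N q.1) - steinFun p z (M q.1 + q.2)| ≤ D q) :
    kolmogorovDist (μ.map fun ω => p * (M ω : ℝ)) (expMeasure 1) ≤
      ENNReal.ofReal (p + ∫ q, D q ∂(smoothedMeasure μ)) := by
  refine iSup_le fun z => ENNReal.ofReal_le_ofReal ?_
  have hD0 : 0 ≤ ∫ q, D q ∂(smoothedMeasure μ) :=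
    integral_nonneg_of_ae ((hle 0).mono fun q hq => (abs_nonneg _).trans hq)
  have := isProbabilityMeasure_expMeasure one_pos
  rw [← cdf_eq_real (expMeasure 1), cdf_expMeasure_eq one_pos, one_mul,
    map_measureReal_apply (by fun_prop) measurableSet_Iic]
  change |μ.real {ω | p * (M ω : ℝ) ≤ z} - _| ≤ _
  split_ifs with hz
  · have h1 := abs_measureReal_sub_smoothed_le hM hp (fun k => by
      rw [hlaw]; exact mul_le_of_le_one_right hp.le measureReal_le_one) z
    have h2 : |(smoothedMeasure μ).real {q | p * (M q.1 + q.2) ≤ z} - (1 - Real.exp (-z))| ≤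
        ∫ q, D q ∂(smoothedMeasure μ) := by
      rw [smoothed_sub_exp_eq hM hN hp hlaw hz]
      rw [← Real.norm_eq_abs]
      refine norm_integral_le_of_norm_le hD ?_
      simpa only [Real.norm_eq_abs] using hle z
    exact (abs_sub_le _ _ _).trans (add_le_add h1 h2)
  -- For z < 0 both distribution functions vanish.
  · have : {ω | p * (M ω : ℝ) ≤ z} = ∅ := by
      refine Set.eq_empty_of_forall_notMem fun ω (hω : _ ≤ z) => hz ?_
      exact (by positivity : 0 ≤ p * (M ω : ℝ)).trans hω
    rw [this]
    simpa using by linarith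

theorem kolmogorovDist_exp_le_lintegral (hM : Measurable M) (hN : Measurable N) (hp : 0 < p)
    (hlaw : ∀ k : ℕ, μ.real {ω | M ω = k} = p * μ.real {ω | k < N ω}) :
    kolmogorovDist (μ.map fun ω => p * (M ω : ℝ)) (expMeasure 1) ≤
      3 / 2 * ENNReal.ofReal p +
        ENNReal.ofReal p * ∫⁻ ω, ENNReal.ofReal |(M ω : ℝ) - N ω| ∂μ := by
  by_cases hfin : ∫⁻ ω, ENNReal.ofReal |(M ω : ℝ) - N ω| ∂μ = ∞
  · simp [hfin, hp]
  have hint : Integrable (fun ω => |(M ω : ℝ) - N ω|) μ :=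
    (lintegral_ofReal_ne_top_iff_integrable (by fun_prop)
      (Filter.Eventually.of_forall fun ω => abs_nonneg _)).1 hfin
  have hU : Integrable (fun x : ℝ => x) (volume.restrict (Set.Icc (0 : ℝ) 1)) :=
    continuous_id.integrableOn_Icc
  have hUm : ∫ x in Set.Icc (0 : ℝ) 1, x = 1 / 2 := by
    rw [integral_Icc_eq_integral_Ioc, ← intervalIntegral.integral_of_le zero_le_one, integral_id]
    norm_num
  have hi1 : Integrable (fun q : Ω × ℝ => |(M q.1 : ℝ) - N q.1|) (smoothedMeasure μ) :=
    hint.comp_fst _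
  have hi2 : Integrable (fun q : Ω × ℝ => q.2) (smoothedMeasure μ) := hU.comp_snd _
  -- |N - (M + U)| ≤ |M - N| + U with E U = 1/2; together with the p lost in removing U this yields
  -- the constant 3/2.
  refine (kolmogorovDist_exp_le hM hN hp hlaw
    (D := fun q => p * (|(M q.1 : ℝ) - N q.1| + q.2)) ((hi1.add hi2).const_mul p)
    fun z => ?_).trans_eq ?_
  · filter_upwards [ae_smoothed_mem_Icc] with q hq
    refine (abs_steinFun_sub_le hp.le z _ _).trans (mul_le_mul_of_nonneg_left ?_ hp.le)
    rw [← sub_sub, abs_sub_comm (M q.1 : ℝ)]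
    exact (abs_sub _ _).trans_eq (by rw [abs_of_nonneg hq.1])
  · rw [integral_const_mul, integral_add hi1 hi2,
      integral_fun_fst (f := fun ω => |(M ω : ℝ) - N ω|), integral_fun_snd (f := fun x : ℝ => x), hUm,
      ← ofReal_integral_eq_lintegral_ofReal hint (Filter.Eventually.of_forall fun ω => abs_nonneg _),
      ← ENNReal.ofReal_mul hp.le]
    have h32 : (3 / 2 : ℝ≥0∞) = ENNReal.ofReal (3 / 2) := by
      rw [ENNReal.ofReal_div_of_pos two_pos]; simp
    have h0 : 0 ≤ ∫ ω, |(M ω : ℝ) - N ω| ∂μ := integral_nonneg fun ω => abs_nonneg _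
    rw [h32, ← ENNReal.ofReal_mul (by norm_num), ← ENNReal.ofReal_add (by positivity) (by positivity)]
    congr 1
    simp
    ring

theorem kolmogorovDist_exp_le_measure_ne (hM : Measurable M) (hN : Measurable N) (hp : 0 < p)
    (hlaw : ∀ k : ℕ, μ.real {ω | M ω = k} = p * μ.real {ω | k < N ω}) :
    kolmogorovDist (μ.map fun ω => p * (M ω : ℝ)) (expMeasure 1) ≤
      2 * ENNReal.ofReal p + μ {ω | M ω ≠ N ω} := by
  have hB : MeasurableSet {ω | M ω ≠ N ω} := (measurableSet_eq_fun hM hN).compl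
  have hi : Integrable ({ω | M ω ≠ N ω}.indicator (fun _ => (1 : ℝ))) μ :=
    (integrable_const _).indicator hB
  -- Where M = N the Lipschitz bound gives p U ≤ p, elsewhere the range [0, 1] gives 1. This p and
  -- the one lost in removing U make the constant 2.
  refine (kolmogorovDist_exp_le hM hN hp hlaw
    (D := fun q => p + {ω | M ω ≠ N ω}.indicator (fun _ => (1 : ℝ)) q.1)
    ((integrable_const p).add (hi.comp_fst _)) fun z => ?_).trans_eq ?_
  · filter_upwards [ae_smoothed_mem_Icc] with q hq
    by_cases h : M q.1 = N q.1
    · rw [Set.indicator_of_notMem (by simpa using h), add_zero, h]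
      refine (abs_steinFun_sub_le hp.le z _ _).trans (mul_le_of_le_one_right hp.le ?_)
      rw [sub_add_cancel_left, abs_neg, abs_of_nonneg hq.1]
      exact hq.2
    · rw [Set.indicator_of_mem (by exact h)]
      refine le_trans ?_ (le_add_of_nonneg_left hp.le)
      exact abs_sub_le_of_le_of_le (steinFun_nonneg _ _ _) (steinFun_le_one _ _ _)
        (steinFun_nonneg _ _ _) (steinFun_le_one _ _ _) |>.trans_eq (sub_zero 1)
  · rw [integral_add (integrable_const p) (hi.comp_fst _), integral_fun_fst,
      integral_indicator_const _ hB]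
    simp only [integral_const, probReal_univ, smul_eq_mul, one_mul, mul_one]
    rw [← add_assoc, ENNReal.ofReal_add (by positivity) measureReal_nonneg,
      ENNReal.ofReal_add hp.le hp.le, two_mul, ofReal_measureReal]

end Stein

/-! ### The law identity linking the two passage times -/

section Coupling

variable {S : Type*} [Countable S] [MeasurableSpace S] [MeasurableSingletonClass S]
  {Ω : Type*} [MeasurableSpace Ω] {μ : Measure Ω} [IsProbabilityMeasure μ] {X Y : ℕ → Ω → S}
  {π : PMF S} {P : S → PMF S} {i : S}

/-- The first passage time from stationarity has the law `P(T = k) = π i * P_i(T_i > k)`. -/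
lemma measureReal_hitTime_eq (hX : IsMarkovChain μ X π P) (hY : IsMarkovChain μ Y (PMF.pure i) P)
    (hstat : IsStationaryLaw P π) (hXt : ∀ᵐ ω ∂μ, hitTime X i 0 ω ≠ ⊤)
    (hYt : ∀ᵐ ω ∂μ, hitTime Y i 1 ω ≠ ⊤) (k : ℕ) :
    μ.real {ω | (hitTime X i 0 ω).toNat = k} =
      (π i).toReal * μ.real {ω | k < (hitTime Y i 1 ω).toNat} := by
  have h1 : μ {ω | (hitTime X i 0 ω).toNat = k} = π i * avoidProb P i k i := by
    rw [← hX.measure_first_visit hstat i k]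
    refine measure_congr ?_
    filter_upwards [hXt] with ω hω
    refine propext (Iff.trans ?_ (hitTime_zero_eq_iff (n := k)))
    obtain ⟨m, hm⟩ := ENat.ne_top_iff_exists.1 hω
    rw [← hm, Nat.cast_inj]
    change ENat.toNat _ = k ↔ _
    rw [← hm, ENat.toNat_natCast]
  have h2 : μ {ω | k < (hitTime Y i 1 ω).toNat} = avoidProb P i k i := by
    rw [← hY.measure_avoid_pure]
    refine measure_congr ?_
    filter_upwards [hYt] with ω hω
    refine propext (Iff.trans ?_ (lt_hitTime_iff (m := 1) (n := k)))
    obtain ⟨m, hm⟩ := ENat.ne_top_iff_exists.1 hω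
    rw [← hm, Nat.cast_lt]
    change k < ENat.toNat _ ↔ _
    rw [← hm, ENat.toNat_natCast]
  rw [measureReal_def, measureReal_def, h1, h2, ENNReal.toReal_mul]

end Coupling

end FirstPassage

open FirstPassage
theorem mainTheorem6 {S : Type*} [Countable S] [MeasurableSpace S] [MeasurableSingletonClass S]
    (P : S → PMF S) (π : PMF S) (hirr : IsIrreducibleChain P) (hstat : IsStationaryLaw P π) (i : S)
    {Ω : Type*} [MeasurableSpace Ω] (μ : Measure Ω) [IsProbabilityMeasure μ]
    (X Y : ℕ → Ω → S) (hX : IsMarkovChain μ X π P) (hY : IsMarkovChain μ Y (PMF.pure i) P) :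
    (∀ᵐ ω ∂μ, hitTime X i 0 ω ≠ ⊤) ∧ (∀ᵐ ω ∂μ, hitTime Y i 1 ω ≠ ⊤) ∧
    kolmogorovDist (μ.map fun ω => (π i).toReal * realTime (hitTime X i 0 ω)) (expMeasure 1) ≤
      3 / 2 * π i +
        π i * ∫⁻ ω, ENNReal.ofReal
          |realTime (hitTime X i 0 ω) - realTime (hitTime Y i 1 ω)| ∂μ ∧
    kolmogorovDist (μ.map fun ω => (π i).toReal * realTime (hitTime X i 0 ω)) (expMeasure 1) ≤
      2 * π i + μ {ω | hitTime X i 0 ω ≠ hitTime Y i 1 ω} ∧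
    IsEquilibriumLaw (μ.map fun ω => realTime (hitTime Y i 1 ω))
      ((μ.prod (volume.restrict (Set.Icc (0 : ℝ) 1))).map
        fun p => realTime (hitTime X i 0 p.1) + p.2) := by
  have hz := hX.iInf_avoidProb_eq_zero hstat hirr i
  have hXt : ∀ᵐ ω ∂μ, hitTime X i 0 ω ≠ ⊤ := by
    filter_upwards [hX.ae_exists_visit hz] with ω ⟨n, _, hn⟩
    exact hitTime_ne_top_iff.2 ⟨n, Nat.zero_le n, hn⟩
  have hYt : ∀ᵐ ω ∂μ, hitTime Y i 1 ω ≠ ⊤ := by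
    filter_upwards [hY.ae_exists_visit hz] with ω ⟨n, hn0, hn⟩
    exact hitTime_ne_top_iff.2 ⟨n, hn0, hn⟩
  have hM := measurable_toNat_hitTime (i := i) (m := 0) hX.measurable
  have hN := measurable_toNat_hitTime (i := i) (m := 1) hY.measurable
  have hp : 0 < (π i).toReal := ENNReal.toReal_pos (hstat.ne_zero hirr i) (π.apply_ne_top i)
  have hlaw := measureReal_hitTime_eq hX hY hstat hXt hYt
  have hpe : ENNReal.ofReal (π i).toReal = π i := ENNReal.ofReal_toReal (π.apply_ne_top i)
  refine ⟨hXt, hYt, ?_, ?_, isEquilibriumLaw_of_law hM hN hp hlaw⟩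
  · have h := kolmogorovDist_exp_le_lintegral hM hN hp hlaw
    rwa [hpe] at h
  · have h := kolmogorovDist_exp_le_measure_ne hM hN hp hlaw
    rw [hpe] at h
    -- An inclusion suffices: `ENat.toNat` may identify ⊤ with 0, but it never separates equal
    -- times.
    have hsub : {ω | (hitTime X i 0 ω).toNat ≠ (hitTime Y i 1 ω).toNat} ⊆
        {ω | hitTime X i 0 ω ≠ hitTime Y i 1 ω} :=
      fun ω hω heq => hω (congrArg ENat.toNat heq)
    exact h.trans (add_le_add_right (measure_mono hsub) _)
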